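/- For a locally compact group $G$ with a fixed left Haar measure, $s\in G$ and $f\in L^1(G)$, write $(\delta_s*f*\delta_{s^{-1}})(x)=\Delta(s)\,f(s^{-1}xs)$, where $\Delta$ is the modular function of $G$ (with $\int f(xs)\,dx=\Delta(s)^{-1}\int f(x)\,dx$), so that $f\mapsto\delta_s*f*\delta_{s^{-1}}$ is an isometry of $L^1(G)$. The group $G$ is called QSIN (quasi-small invariant neighbourhood) if $L^1(G)$ admits a bounded approximate identity which is asymptotically inner invariant, that is, a net $(e_\alpha)$ in $L^1(G)$ with $\sup_\alpha\|e_\alpha\|_1<\infty$ such that $\|e_\alpha*f-f\|_1\to0$ and $\|f*e_\alpha-f\|_1\to0$ for every $f\in L^1(G)$, and $\|\delta_s*e_\alpha*\delta_{s^{-1}}-e_\alpha\|_1\to0$ for every $s\in G$. Let $\Gamma$ be a dense subgroup of $\mathrm{SL}_2(\mathbb{R})$, regarded as a discrete group, and let $G=\mathbb{R}^2\rtimes\Gamma$ be the semidirect product for the natural linear action of $\Gamma$ on $\mathbb{R}^2$, with the product of the usual topology of $\mathbb{R}^2$ and the discrete topology of $\Gamma$. Then the locally compact group $G$ is not QSIN.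 -/

import Mathlib

open MeasureTheory Filter Topology
open scoped NNReal ENNReal MatrixGroups

/-! ## Quasi-small invariant neighbourhood groups -/

section QSIN

universe u

variable {G : Type u} [Group G] [TopologicalSpace G] [IsTopologicalGroup G]
  [LocallyCompactSpace G] [MeasurableSpace G] [BorelSpace G]

/-- The `L¹`-norm (with values in `[0, ∞]`) with respect to left Haar measure. -/
noncomputable def haarL1Norm (f : G → ℂ) : ℝ≥0∞ :=
  eLpNorm f 1 (Measure.haar : Measure G)

/-- Convolution in `L¹(G)`: `(f * g)(x) = ∫ f(y) g(y⁻¹ x) dy` for left Haar measure `dy`. -/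
noncomputable def haarConv (f g : G → ℂ) (x : G) : ℂ :=
  ∫ y, f y * g (y⁻¹ * x) ∂(Measure.haar : Measure G)

/-- The inner action of `s` on `L¹(G)`, that is, `f ↦ δ_s * f * δ_{s⁻¹}`. Mathlib's modular
character `m` satisfies `∫ f(x s) dx = m(s) ∫ f(x) dx`, so that the factor `m(s)⁻¹` makes this
action isometric on `L¹(G)`. -/
noncomputable def innerTranslate (s : G) (f : G → ℂ) (x : G) : ℂ :=
  (((Measure.modularCharacter s)⁻¹ : ℝ≥0) : ℂ) * f (s⁻¹ * x * s)

/-- The net `e` in `L¹(G)` is a bounded (two-sided) approximate identity. -/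
structure IsBoundedApproxIdentity {ι : Type*} [Preorder ι] (e : ι → G → ℂ) : Prop where
  integrable : ∀ i, Integrable (e i) (Measure.haar : Measure G)
  bounded : ∃ C : ℝ≥0, ∀ i, haarL1Norm (e i) ≤ C
  left_approx : ∀ f : G → ℂ, Integrable f (Measure.haar : Measure G) →
    Tendsto (fun i => haarL1Norm (haarConv (e i) f - f)) atTop (𝓝 0)
  right_approx : ∀ f : G → ℂ, Integrable f (Measure.haar : Measure G) →
    Tendsto (fun i => haarL1Norm (haarConv f (e i) - f)) atTop (𝓝 0)

/-- The net `e` is asymptotically inner invariant: `‖δ_s * e_i * δ_{s⁻¹} - e_i‖₁ → 0` for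
each `s` in `G`. -/
def IsAsymptoticallyInnerInvariant {ι : Type*} [Preorder ι] (e : ι → G → ℂ) : Prop :=
  ∀ s : G, Tendsto (fun i => haarL1Norm (innerTranslate s (e i) - e i)) atTop (𝓝 0)

variable (G) in
/-- A locally compact group `G` is QSIN (quasi-small invariant neighbourhood) if `L¹(G)` admits a
bounded approximate identity which is asymptotically inner invariant. -/
def IsQSIN : Prop :=
  ∃ (ι : Type u) (_ : Preorder ι) (_ : IsDirectedOrder ι) (_ : Nonempty ι) (e : ι → G → ℂ),
    IsBoundedApproxIdentity e ∧ IsAsymptoticallyInnerInvariant e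

end QSIN

/-! ## The group `ℝ² ⋊ Γ` with `Γ` discrete -/

/-- The natural linear action of a subgroup `Γ` of `SL₂(ℝ)` on `ℝ²` by automorphisms. -/
noncomputable def planeAction (Γ : Subgroup SL(2, ℝ)) :
    Γ →* MulAut (Multiplicative (Fin 2 → ℝ)) where
  toFun γ := AddEquiv.toMultiplicative
    (Matrix.SpecialLinearGroup.toLin' (γ : SL(2, ℝ))).toAddEquiv
  map_one' := by ext x; simp
  map_mul' a b := by ext x; simp

/-- The semidirect product `ℝ² ⋊ Γ`, with `(v, γ)(w, δ) = (v + γ w, γ δ)`. -/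
abbrev PlaneSemidirect (Γ : Subgroup SL(2, ℝ)) : Type :=
  Multiplicative (Fin 2 → ℝ) ⋊[planeAction Γ] Γ

namespace PlaneSemidirect

variable (Γ : Subgroup SL(2, ℝ))

/-- The product topology of the usual topology on `ℝ²` and the discrete topology on `Γ`. -/
noncomputable instance instTopologicalSpace : TopologicalSpace (PlaneSemidirect Γ) :=
  TopologicalSpace.induced SemidirectProduct.equivProd
    (@instTopologicalSpaceProd (Multiplicative (Fin 2 → ℝ)) Γ inferInstance ⊥)

theorem continuous_left : Continuous (fun x : PlaneSemidirect Γ => x.left) :=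
  letI : TopologicalSpace Γ := ⊥
  continuous_fst.comp (continuous_induced_dom (f := SemidirectProduct.equivProd))

theorem continuous_right :
    @Continuous (PlaneSemidirect Γ) Γ _ ⊥ (fun x : PlaneSemidirect Γ => x.right) :=
  letI : TopologicalSpace Γ := ⊥
  continuous_snd.comp (continuous_induced_dom (f := SemidirectProduct.equivProd))

theorem continuous_planeAction (γ : Γ) : Continuous (planeAction Γ γ) :=
  (Matrix.toLin' (γ : SL(2, ℝ)).1).continuous_of_finiteDimensional

/-- The action is jointly continuous along any map that is continuous to the discrete `Γ`. -/
theorem continuous_act {X : Type*} [TopologicalSpace X] {g : X → Γ}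
    {v : X → Multiplicative (Fin 2 → ℝ)} (hg : @Continuous X Γ _ ⊥ g) (hv : Continuous v) :
    Continuous (fun x => planeAction Γ (g x) (v x)) := by
  let _ : TopologicalSpace Γ := ⊥
  have : DiscreteTopology Γ := ⟨rfl⟩
  rw [continuous_iff_continuousAt]
  intro x
  have hopen : ∀ᶠ y in 𝓝 x, g y = g x :=
    ((isOpen_discrete {g x}).preimage hg).mem_nhds rfl
  refine (((continuous_planeAction Γ (g x)).comp hv).continuousAt).congr ?_
  filter_upwards [hopen] with y hy
  simp [hy]

instance instIsTopologicalGroup : IsTopologicalGroup (PlaneSemidirect Γ) := by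
  let _ : TopologicalSpace Γ := ⊥
  have : DiscreteTopology Γ := ⟨rfl⟩
  have hl := continuous_left Γ
  have hr : Continuous (fun x : PlaneSemidirect Γ => x.right) := continuous_right Γ
  have hr1 : Continuous (fun p : PlaneSemidirect Γ × PlaneSemidirect Γ => p.1.right) :=
    hr.comp continuous_fst
  have hr2 : Continuous (fun p : PlaneSemidirect Γ × PlaneSemidirect Γ => p.2.right) :=
    hr.comp continuous_snd
  have hri : Continuous (fun x : PlaneSemidirect Γ => x.right⁻¹) :=
    (continuous_of_discreteTopology (f := fun γ : Γ => γ⁻¹)).comp hr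
  exact
    { continuous_mul := continuous_induced_rng.2 (Continuous.prodMk
        ((hl.comp continuous_fst).mul (continuous_act Γ hr1 (hl.comp continuous_snd)))
        ((continuous_of_discreteTopology (f := fun q : Γ × Γ => q.1 * q.2)).comp
          (hr1.prodMk hr2)))
      continuous_inv := continuous_induced_rng.2 (Continuous.prodMk
        (continuous_act Γ hri hl.inv) hri) }

instance instLocallyCompactSpace : LocallyCompactSpace (PlaneSemidirect Γ) := by
  let _ : TopologicalSpace Γ := ⊥
  have : DiscreteTopology Γ := ⟨rfl⟩
  exact (SemidirectProduct.equivProd.toHomeomorphOfIsInducing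
    ⟨rfl⟩ : PlaneSemidirect Γ ≃ₜ _).isClosedEmbedding.locallyCompactSpace

instance instT2Space : T2Space (PlaneSemidirect Γ) := by
  let _ : TopologicalSpace Γ := ⊥
  have : DiscreteTopology Γ := ⟨rfl⟩
  exact (SemidirectProduct.equivProd.toHomeomorphOfIsInducing
    ⟨rfl⟩ : PlaneSemidirect Γ ≃ₜ _).isEmbedding.t2Space

noncomputable instance instMeasurableSpace : MeasurableSpace (PlaneSemidirect Γ) := borel _

instance instBorelSpace : BorelSpace (PlaneSemidirect Γ) := ⟨rfl⟩

end PlaneSemidirect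

/-!
Along an asymptotically inner invariant net `e`, the masses `∫_A |e i|` are asymptotically invariant
under conjugation. Hence they tend to `0` on a wandering set `W`, one with infinitely many pairwise
disjoint conjugates, and then on every finite union of conjugates of `W` as well; being an
approximate identity, `e` cannot lose its mass near `1` in this way. In `ℝ² ⋊ Γ` conjugation by `Γ`
is the linear action on the plane. The open cone `W` of directions away from both coordinate axes
is wandering under a strongly hyperbolic diagonal matrix, and a suitable second matrix moves the
directions near the axes into `W`. Both properties are open in the matrix, so dense subgroups
contain matrices which have them.
-/

open scoped Pointwise Matrix

theorem conj_smul_set_eq_preimage {G : Type*} [Group G] (s : G) (A : Set G) :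
    MulAut.conj s • A = (fun x => s⁻¹ * x * s) ⁻¹' A := by
  ext x
  simp [Set.mem_smul_set_iff_inv_smul_mem, ← map_inv]

section ConjugationMass

universe u

variable {G : Type u} [Group G] [TopologicalSpace G] [IsTopologicalGroup G]
  [LocallyCompactSpace G] [MeasurableSpace G] [BorelSpace G]

theorem measurePreserving_conj_modularCharacter_smul (μ : Measure G) [μ.IsHaarMeasure] [μ.Regular]
    (s : G) :
    MeasurePreserving (fun x => s⁻¹ * x * s) μ (Measure.modularCharacter s • μ) := by
  have : (μ.map (· * s)).Regular := Measure.Regular.map (Homeomorph.mulRight s)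
  have hright : μ.map (· * s) = Measure.modularCharacter s • μ := by
    rw [Measure.isMulLeftInvariant_eq_smul_of_regular (μ.map (· * s)) μ,
      ← Measure.modularCharacterFun_eq_haarScalarFactor]
    rfl
  exact MeasurePreserving.comp ⟨measurable_mul_const s, hright⟩ (measurePreserving_mul_left μ s⁻¹)

theorem setLIntegral_enorm_innerTranslate (s : G) (f : G → ℂ) (A : Set G) :
    ∫⁻ x in MulAut.conj s • A, ‖innerTranslate s f x‖ₑ ∂Measure.haar =
      ∫⁻ x in A, ‖f x‖ₑ ∂Measure.haar := by
  have hemb : MeasurableEmbedding fun x : G => s⁻¹ * x * s :=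
    (MeasurableEquiv.mulRight s).measurableEmbedding.comp
      (MeasurableEquiv.mulLeft s⁻¹).measurableEmbedding
  have hm : Measure.modularCharacter s ≠ 0 := (Measure.modularCharacterFun_pos s).ne'
  have hnorm (x : G) : ‖innerTranslate s f x‖ₑ =
      ((Measure.modularCharacter s)⁻¹ : ℝ≥0) * ‖f (s⁻¹ * x * s)‖ₑ := by
    rw [innerTranslate, enorm_mul, ← ofReal_norm, Complex.norm_real, NNReal.norm_eq,
      ENNReal.ofReal_coe_nnreal]
  simp_rw [hnorm]
  rw [lintegral_const_mul' _ _ ENNReal.coe_ne_top, conj_smul_set_eq_preimage,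
    (measurePreserving_conj_modularCharacter_smul Measure.haar s).setLIntegral_comp_preimage_emb
      hemb (fun x => ‖f x‖ₑ) A, Measure.restrict_smul, lintegral_smul_measure, ENNReal.smul_def,
    smul_eq_mul, ← mul_assoc, ← ENNReal.coe_mul, inv_mul_cancel₀ hm, ENNReal.coe_one, one_mul]

theorem setLIntegral_enorm_le_conj_smul_add (s : G) {f : G → ℂ}
    (hf : Integrable f (Measure.haar : Measure G)) (A : Set G) :
    ∫⁻ x in A, ‖f x‖ₑ ∂Measure.haar ≤
      ∫⁻ x in MulAut.conj s • A, ‖f x‖ₑ ∂Measure.haar +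
        haarL1Norm (innerTranslate s f - f) := by
  rw [haarL1Norm, eLpNorm_one_eq_lintegral_enorm, ← setLIntegral_enorm_innerTranslate s f A]
  calc
    _ ≤ ∫⁻ x in MulAut.conj s • A, (‖f x‖ₑ + ‖(innerTranslate s f - f) x‖ₑ) ∂Measure.haar :=
      lintegral_mono fun x => by simpa using enorm_add_le (f x) ((innerTranslate s f - f) x)
    _ = ∫⁻ x in MulAut.conj s • A, ‖f x‖ₑ ∂Measure.haar +
        ∫⁻ x in MulAut.conj s • A, ‖(innerTranslate s f - f) x‖ₑ ∂Measure.haar :=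
      lintegral_add_left' hf.aestronglyMeasurable.enorm.restrict _
    _ ≤ _ := by gcongr; exact Measure.restrict_le_self

end ConjugationMass

theorem pairwise_disjoint_pow_smul {M α : Type*} [Group M] [MulAction M α] {a : M} {A : Set α}
    (h : ∀ n ≠ 0, Disjoint A (a ^ n • A)) :
    Pairwise (Function.onFun Disjoint fun n : ℕ => a ^ n • A) := by
  refine (pairwise_disjoint_on _).2 fun m n hmn => ?_
  rw [← Nat.add_sub_cancel' hmn.le, pow_add, mul_smul, Set.disjoint_smul_set]
  exact h _ (Nat.sub_ne_zero_of_lt hmn)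

section AsymptoticallyNull

universe u

variable {G : Type u} [Group G] [TopologicalSpace G] [IsTopologicalGroup G]
  [LocallyCompactSpace G] [MeasurableSpace G] [BorelSpace G]
  {ι : Type*} [Preorder ι] {e : ι → G → ℂ} {A B : Set G}

/-- A set is asymptotically null for a net `e` of functions on `G` if the Haar mass of `|e i|` on
it tends to `0`. For an asymptotically inner invariant net these sets form a conjugation invariant
ideal. -/
def IsAsymptoticallyNull (e : ι → G → ℂ) (A : Set G) : Prop :=
  Tendsto (fun i => ∫⁻ x in A, ‖e i x‖ₑ ∂(Measure.haar : Measure G)) atTop (𝓝 0)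

namespace IsAsymptoticallyNull

theorem of_measure_eq_zero (hA : (Measure.haar : Measure G) A = 0) : IsAsymptoticallyNull e A := by
  simpa only [IsAsymptoticallyNull, setLIntegral_measure_zero _ _ hA] using tendsto_const_nhds

theorem mono (hB : IsAsymptoticallyNull e B) (hAB : A ⊆ B) : IsAsymptoticallyNull e A :=
  tendsto_of_tendsto_of_tendsto_of_le_of_le tendsto_const_nhds hB (fun _ => zero_le)
    fun _ => lintegral_mono_set hAB

theorem union (hA : IsAsymptoticallyNull e A) (hB : IsAsymptoticallyNull e B) :
    IsAsymptoticallyNull e (A ∪ B) := by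
  have h := Tendsto.add hA hB
  rw [add_zero] at h
  exact tendsto_of_tendsto_of_tendsto_of_le_of_le tendsto_const_nhds h (fun _ => zero_le)
    fun _ => lintegral_union_le _ _ _

theorem iUnion {κ : Type*} [Finite κ] {A : κ → Set G} (hA : ∀ k, IsAsymptoticallyNull e (A k)) :
    IsAsymptoticallyNull e (⋃ k, A k) := by
  have := Fintype.ofFinite κ
  have h := tendsto_finsetSum Finset.univ fun k _ => hA k
  rw [Finset.sum_const_zero] at h
  refine tendsto_of_tendsto_of_tendsto_of_le_of_le tendsto_const_nhds h (fun _ => zero_le)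
    fun _ => ?_
  exact (lintegral_iUnion_le _ _).trans_eq (tsum_fintype _)

theorem conj_smul (he : ∀ i, Integrable (e i) (Measure.haar : Measure G))
    (hinv : IsAsymptoticallyInnerInvariant e) (hA : IsAsymptoticallyNull e A) (s : G) :
    IsAsymptoticallyNull e (MulAut.conj s • A) := by
  have h := Tendsto.add hA (hinv s⁻¹)
  rw [add_zero] at h
  refine tendsto_of_tendsto_of_tendsto_of_le_of_le tendsto_const_nhds h (fun _ => zero_le)
    fun i => ?_
  simpa [map_inv] using setLIntegral_enorm_le_conj_smul_add s⁻¹ (he i) (MulAut.conj s • A)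

end IsAsymptoticallyNull

theorem nsmul_setLIntegral_enorm_le_of_pairwise_disjoint_conj_smul {f : G → ℂ}
    (hf : Integrable f (Measure.haar : Measure G)) (hA : MeasurableSet A) {g : ℕ → G}
    (hg : Pairwise (Function.onFun Disjoint fun n => MulAut.conj (g n) • A)) (n : ℕ) :
    n • ∫⁻ x in A, ‖f x‖ₑ ∂Measure.haar ≤
      haarL1Norm f + ∑ k ∈ Finset.range n, haarL1Norm (innerTranslate (g k) f - f) := by
  have hmeas (s : G) : MeasurableSet (MulAut.conj s • A) := by
    rw [conj_smul_set_eq_preimage]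
    exact hA.preimage ((measurable_const_mul s⁻¹).mul_const s)
  calc
    n • ∫⁻ x in A, ‖f x‖ₑ ∂Measure.haar
        = ∑ _k ∈ Finset.range n, ∫⁻ x in A, ‖f x‖ₑ ∂Measure.haar := by simp
    _ ≤ ∑ k ∈ Finset.range n, (∫⁻ x in MulAut.conj (g k) • A, ‖f x‖ₑ ∂Measure.haar +
          haarL1Norm (innerTranslate (g k) f - f)) :=
      Finset.sum_le_sum fun k _ => setLIntegral_enorm_le_conj_smul_add (g k) hf A
    _ = ∫⁻ x in ⋃ k ∈ Finset.range n, MulAut.conj (g k) • A, ‖f x‖ₑ ∂Measure.haar +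
          ∑ k ∈ Finset.range n, haarL1Norm (innerTranslate (g k) f - f) := by
      rw [Finset.sum_add_distrib,
        lintegral_biUnion_finset (hg.set_pairwise _) fun k _ => hmeas (g k)]
    _ ≤ _ := by
      rw [haarL1Norm, eLpNorm_one_eq_lintegral_enorm]
      gcongr
      exact Measure.restrict_le_self

theorem IsAsymptoticallyInnerInvariant.isAsymptoticallyNull_of_pairwise_disjoint_conj_smul
    (hinv : IsAsymptoticallyInnerInvariant e) (he : IsBoundedApproxIdentity e)
    (hA : MeasurableSet A) {g : ℕ → G}
    (hg : Pairwise (Function.onFun Disjoint fun n => MulAut.conj (g n) • A)) :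
    IsAsymptoticallyNull e A := by
  obtain ⟨C, hC⟩ := he.bounded
  refine ENNReal.tendsto_nhds_zero.2 fun ε hε => ?_
  obtain ⟨n, hn⟩ : ∃ n : ℕ, (C + 1 : ℝ≥0∞) < n * ε :=
    ENNReal.exists_nat_mul_gt hε.ne' (by finiteness)
  have hsum : Tendsto (fun i => ∑ k ∈ Finset.range n, haarL1Norm (innerTranslate (g k) (e i) - e i))
      atTop (𝓝 0) := by
    simpa using tendsto_finsetSum (Finset.range n) fun k _ => hinv (g k)
  filter_upwards [hsum.eventually_le_const one_pos] with i hi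
  by_contra! hlt
  have hle := nsmul_setLIntegral_enorm_le_of_pairwise_disjoint_conj_smul (he.integrable i) hA hg n
  rw [nsmul_eq_mul] at hle
  refine hn.not_ge ?_
  calc n * ε ≤ n * ∫⁻ x in A, ‖e i x‖ₑ ∂Measure.haar := by gcongr
    _ ≤ C + 1 := hle.trans (add_le_add (hC i) hi)

theorem enorm_haarConv_indicator_one_le {f : G → ℂ} {K U : Set G} (hU : K * K⁻¹ ⊆ U) {x : G}
    (hx : x ∈ K) :
    ‖haarConv f (K.indicator 1) x‖ₑ ≤ ∫⁻ y in U, ‖f y‖ₑ ∂Measure.haar := by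
  calc
    _ ≤ ∫⁻ y, ‖f y * K.indicator 1 (y⁻¹ * x)‖ₑ ∂Measure.haar := enorm_integral_le_lintegral_enorm _
    _ ≤ ∫⁻ y, U.indicator (fun y => ‖f y‖ₑ) y ∂Measure.haar := by
      refine lintegral_mono fun y => ?_
      by_cases hy : y⁻¹ * x ∈ K
      · have hyU : y ∈ U := hU (by simpa using Set.mul_mem_mul hx (Set.inv_mem_inv.2 hy))
        simp [hy, hyU]
      · simp [hy]
    _ ≤ _ := lintegral_indicator_le _ _

theorem haar_le_setLIntegral_enorm_mul_add {f : G → ℂ} {K U : Set G} (hK : MeasurableSet K)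
    (hU : K * K⁻¹ ⊆ U) :
    Measure.haar K ≤ (∫⁻ x in U, ‖f x‖ₑ ∂Measure.haar) * Measure.haar K +
      haarL1Norm (haarConv f (K.indicator 1) - K.indicator 1) := by
  have hone {x : G} (hx : x ∈ K) : 1 ≤ ∫⁻ y in U, ‖f y‖ₑ ∂Measure.haar +
      ‖(haarConv f (K.indicator 1) - K.indicator (1 : G → ℂ)) x‖ₑ := by
    have h := enorm_sub_le (a := haarConv f (K.indicator 1) x)
      (b := (haarConv f (K.indicator 1) - K.indicator (1 : G → ℂ)) x)
    simp only [Pi.sub_apply, sub_sub_cancel, Set.indicator_of_mem hx, Pi.one_apply,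
      enorm_one] at h ⊢
    exact h.trans (by gcongr; exact enorm_haarConv_indicator_one_le hU hx)
  rw [haarL1Norm, eLpNorm_one_eq_lintegral_enorm]
  calc
    Measure.haar K = ∫⁻ _ in K, 1 ∂Measure.haar := by simp
    _ ≤ ∫⁻ x in K, (∫⁻ y in U, ‖f y‖ₑ ∂Measure.haar +
        ‖(haarConv f (K.indicator 1) - K.indicator (1 : G → ℂ)) x‖ₑ) ∂Measure.haar :=
      setLIntegral_mono' hK fun x hx => hone hx
    _ = (∫⁻ x in U, ‖f x‖ₑ ∂Measure.haar) * Measure.haar K +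
        ∫⁻ x in K, ‖(haarConv f (K.indicator 1) - K.indicator (1 : G → ℂ)) x‖ₑ ∂Measure.haar := by
      rw [lintegral_add_left measurable_const, setLIntegral_const]
    _ ≤ _ := by gcongr; exact Measure.restrict_le_self

theorem IsBoundedApproxIdentity.not_isAsymptoticallyNull_of_mem_nhds_one [IsDirectedOrder ι]
    [Nonempty ι] (he : IsBoundedApproxIdentity e) {U : Set G} (hU : U ∈ 𝓝 1) :
    ¬ IsAsymptoticallyNull e U := by
  intro hnull
  obtain ⟨V, hV, hVclosed, hVinv, hVU⟩ := exists_closed_nhds_one_inv_eq_mul_subset hU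
  obtain ⟨L, hL, hLcompact, hLclosed⟩ := exists_mem_nhds_isCompact_isClosed (1 : G)
  have hKclosed : IsClosed (V ∩ L) := hVclosed.inter hLclosed
  have hKU : (V ∩ L) * (V ∩ L)⁻¹ ⊆ U := by
    refine (Set.mul_subset_mul Set.inter_subset_left ?_).trans hVU
    exact (Set.inv_subset_inv.2 Set.inter_subset_left).trans hVinv.subset
  have hpos : 0 < (Measure.haar : Measure G) (V ∩ L) :=
    Measure.measure_pos_of_mem_nhds _ (inter_mem hV hL)
  have hfin : (Measure.haar : Measure G) (V ∩ L) ≠ ⊤ :=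
    (hLcompact.inter_left hVclosed).measure_ne_top
  have hint : Integrable ((V ∩ L).indicator (1 : G → ℂ)) Measure.haar :=
    (integrable_indicator_iff hKclosed.measurableSet).2 (integrableOn_const hfin)
  have hlim := (ENNReal.Tendsto.mul_const hnull (Or.inr hfin)).add (he.left_approx _ hint)
  rw [zero_mul, add_zero] at hlim
  exact hpos.not_ge <| ge_of_tendsto' hlim fun i =>
    haar_le_setLIntegral_enorm_mul_add hKclosed.measurableSet hKU

theorem not_isQSIN_of_disjoint_conj_pow_smul {W U Z : Set G} (hW : MeasurableSet W) {g : G}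
    (hg : ∀ n ≠ 0, Disjoint W (MulAut.conj g ^ n • W)) (hZ : (Measure.haar : Measure G) Z = 0)
    {κ : Type*} [Finite κ] (s : κ → G) (hU : U ∈ 𝓝 1)
    (hcover : U ⊆ Z ∪ ⋃ k, MulAut.conj (s k) • W) : ¬ IsQSIN G := by
  rintro ⟨ι, _, _, _, e, he, hinv⟩
  have hpair : Pairwise (Function.onFun Disjoint fun n => MulAut.conj (g ^ n) • W) := by
    simpa only [map_pow] using pairwise_disjoint_pow_smul hg
  have hnull : IsAsymptoticallyNull e W :=
    hinv.isAsymptoticallyNull_of_pairwise_disjoint_conj_smul he hW hpair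
  have hconj : IsAsymptoticallyNull e (⋃ k, MulAut.conj (s k) • W) :=
    .iUnion fun k => hnull.conj_smul he.integrable hinv (s k)
  exact he.not_isAsymptoticallyNull_of_mem_nhds_one hU
    ((IsAsymptoticallyNull.of_measure_eq_zero hZ).union hconj |>.mono hcover)

end AsymptoticallyNull

section Cones

/-- An open set of vectors stable under scaling by positive numbers. The apex `0` need not belong
to it, and no convexity is assumed. -/
structure IsOpenCone {n : Type*} (A : Set (n → ℝ)) : Prop where
  isOpen : IsOpen A
  smul_mem : ∀ ⦃c : ℝ⦄, 0 < c → ∀ ⦃v⦄, v ∈ A → c • v ∈ A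

theorem IsOpenCone.inter {n : Type*} {A B : Set (n → ℝ)} (hA : IsOpenCone A) (hB : IsOpenCone B) :
    IsOpenCone (A ∩ B) :=
  ⟨hA.isOpen.inter hB.isOpen, fun _ hc _ hv => ⟨hA.smul_mem hc hv.1, hB.smul_mem hc hv.2⟩⟩

theorem isOpenCone_setOf_mul_abs_lt_abs {n : Type*} (a : ℝ) (i j : n) :
    IsOpenCone {v : n → ℝ | a * |v i| < |v j|} where
  isOpen := isOpen_lt (by fun_prop) (by fun_prop)
  smul_mem c hc v hv := by
    simp only [Set.mem_ofPred_eq, Pi.smul_apply, smul_eq_mul, abs_mul, abs_of_pos hc] at hv ⊢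
    rw [mul_left_comm]
    gcongr

theorem IsOpenCone.isOpen_setOf_forall_mem_or_mulVec_mem {m n : Type*} [Fintype n]
    {A : Set (n → ℝ)} {B : Set (m → ℝ)} (hA : IsOpenCone A) (hB : IsOpenCone B) :
    IsOpen {M : Matrix m n ℝ | ∀ v ≠ 0, v ∈ A ∨ M *ᵥ v ∈ B} := by
  have hsphere : {M : Matrix m n ℝ | ∀ v ≠ 0, v ∈ A ∨ M *ᵥ v ∈ B} =
      {M | ∀ v ∈ Metric.sphere (0 : n → ℝ) 1, v ∈ A ∨ M *ᵥ v ∈ B} := by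
    ext M
    refine ⟨fun h v hv => h v (ne_zero_of_mem_unit_sphere ⟨v, hv⟩), fun h v hv => ?_⟩
    have hpos : 0 < ‖v‖ := norm_pos_iff.2 hv
    have hscale : ‖v‖ • ‖v‖⁻¹ • v = v := smul_inv_smul₀ hpos.ne' v
    refine (h (‖v‖⁻¹ • v) (by simp [norm_smul, hpos.ne'])).imp (fun hvA => ?_) fun hvB => ?_
    · simpa only [hscale] using hA.smul_mem hpos hvA
    · simpa only [← Matrix.mulVec_smul, hscale] using hB.smul_mem hpos hvB
  have hopen : IsOpen {p : Matrix m n ℝ × (n → ℝ) | p.2 ∈ A ∨ p.1 *ᵥ p.2 ∈ B} :=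
    (hA.isOpen.preimage continuous_snd).union
      (hB.isOpen.preimage (continuous_fst.matrix_mulVec continuous_snd))
  rw [hsphere, isOpen_iff_eventually]
  exact fun M hM => (isCompact_sphere 0 1).eventually_forall_of_forall_eventually
    fun v hv => hopen.eventually_mem (hM v hv)

theorem IsOpenCone.exists_mem_forall_mem_or_mulVec_mem {n : Type*} [Fintype n] [DecidableEq n]
    {Γ : Set (Matrix.SpecialLinearGroup n ℝ)} (hΓ : Dense Γ) {A B : Set (n → ℝ)}
    (hA : IsOpenCone A) (hB : IsOpenCone B) (g : Matrix.SpecialLinearGroup n ℝ)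
    (hg : ∀ v ≠ 0, v ∈ A ∨ g.1 *ᵥ v ∈ B) : ∃ γ ∈ Γ, ∀ v ≠ 0, v ∈ A ∨ γ.1 *ᵥ v ∈ B := by
  obtain ⟨γ, hγ, hγΓ⟩ := hΓ.inter_open_nonempty _
    ((hA.isOpen_setOf_forall_mem_or_mulVec_mem hB).preimage continuous_subtype_val) ⟨g, hg⟩
  exact ⟨γ, hγΓ, hγ⟩

/-- The open double cone of the vectors close to the horizontal axis. -/
def horizontalCone : Set (Fin 2 → ℝ) := {v | 4 * |v 1| < |v 0|}

/-- The open double cone of the vectors close to the vertical axis. -/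
def verticalCone : Set (Fin 2 → ℝ) := {v | 4 * |v 0| < |v 1|}

/-- The open cone of the vectors away from both axes; it is the wandering set of the argument. -/
def obliqueCone : Set (Fin 2 → ℝ) := {v | 4⁻¹ * |v 0| < |v 1|} ∩ {v | 4⁻¹ * |v 1| < |v 0|}

theorem isOpenCone_horizontalCone : IsOpenCone horizontalCone :=
  isOpenCone_setOf_mul_abs_lt_abs 4 1 0

theorem isOpenCone_verticalCone : IsOpenCone verticalCone :=
  isOpenCone_setOf_mul_abs_lt_abs 4 0 1

theorem isOpenCone_obliqueCone : IsOpenCone obliqueCone :=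
  (isOpenCone_setOf_mul_abs_lt_abs 4⁻¹ 0 1).inter (isOpenCone_setOf_mul_abs_lt_abs 4⁻¹ 1 0)

theorem disjoint_verticalCone_horizontalCone : Disjoint verticalCone horizontalCone := by
  refine Set.disjoint_left.2 fun v hv hh => ?_
  simp only [verticalCone, horizontalCone, Set.mem_ofPred_eq] at hv hh
  linarith [abs_nonneg (v 0), abs_nonneg (v 1)]

theorem disjoint_verticalCone_obliqueCone : Disjoint verticalCone obliqueCone := by
  refine Set.disjoint_left.2 fun v hv ho => ?_
  simp only [verticalCone, obliqueCone, Set.mem_inter_iff, Set.mem_ofPred_eq] at hv ho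
  linarith

theorem disjoint_horizontalCone_obliqueCone : Disjoint horizontalCone obliqueCone := by
  refine Set.disjoint_left.2 fun v hh ho => ?_
  simp only [horizontalCone, obliqueCone, Set.mem_inter_iff, Set.mem_ofPred_eq] at hh ho
  linarith

theorem zero_notMem_horizontalCone : 0 ∉ horizontalCone := by
  simp [horizontalCone]

theorem zero_notMem_obliqueCone : 0 ∉ obliqueCone := by
  simp [obliqueCone]

theorem abs_add_abs_pos_of_ne_zero {v : Fin 2 → ℝ} (hv : v ≠ 0) : 0 < |v 0| + |v 1| := by
  rcases Fin.exists_fin_two.1 (Function.ne_iff.1 hv) with h₀ | h₁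
  · exact add_pos_of_pos_of_nonneg (abs_pos.2 h₀) (abs_nonneg _)
  · exact add_pos_of_nonneg_of_pos (abs_nonneg _) (abs_pos.2 h₁)

-- The matrix divides slopes by `25`, more than the quotient `16` of the slopes bounding the cones.
theorem mem_verticalCone_or_diagonal_mulVec_mem_horizontalCone {v : Fin 2 → ℝ} (hv : v ≠ 0) :
    v ∈ verticalCone ∨ !![5, 0; 0, 5⁻¹] *ᵥ v ∈ horizontalCone := by
  refine or_iff_not_imp_left.2 fun hvert => ?_
  have hle : |v 1| ≤ 4 * |v 0| := not_lt.1 hvert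
  have hpos : 0 < |v 0| + |v 1| := abs_add_abs_pos_of_ne_zero hv
  have himage : !![5, 0; 0, 5⁻¹] *ᵥ v = ![5 * v 0, 5⁻¹ * v 1] := by
    ext i
    fin_cases i <;> simp [Matrix.mulVec, dotProduct]
  rw [himage]
  change 4 * |5⁻¹ * v 1| < |5 * v 0|
  rw [abs_mul, abs_mul, abs_inv, Nat.abs_ofNat]
  linarith

theorem mem_obliqueCone_or_mulVec_mem_obliqueCone {v : Fin 2 → ℝ} (hv : v ≠ 0) :
    v ∈ obliqueCone ∨ !![2, 1; 1, 1] *ᵥ v ∈ obliqueCone := by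
  refine or_iff_not_imp_left.2 fun hobl => ?_
  have hle : |v 1| ≤ 4⁻¹ * |v 0| ∨ |v 0| ≤ 4⁻¹ * |v 1| := by
    simpa only [obliqueCone, Set.mem_inter_iff, Set.mem_ofPred_eq, not_and_or, not_lt] using hobl
  have hpos : 0 < |v 0| + |v 1| := abs_add_abs_pos_of_ne_zero hv
  have himage : !![2, 1; 1, 1] *ᵥ v = ![2 * v 0 + v 1, v 0 + v 1] := by
    ext i
    fin_cases i <;> simp [Matrix.mulVec, dotProduct]
  have htwo : |2 * v 0| = 2 * |v 0| := by rw [abs_mul, abs_two]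
  have hupper₀ : |2 * v 0 + v 1| ≤ 2 * |v 0| + |v 1| := htwo ▸ abs_add_le _ _
  have hupper₁ : |v 0 + v 1| ≤ |v 0| + |v 1| := abs_add_le _ _
  have hlower₀ : |(2 * |v 0| - |v 1|)| ≤ |2 * v 0 + v 1| := by
    simpa [htwo] using abs_abs_sub_abs_le_abs_sub (2 * v 0) (-v 1)
  have hlower₁ : |(|v 0| - |v 1|)| ≤ |v 0 + v 1| := by
    simpa using abs_abs_sub_abs_le_abs_sub (v 0) (-v 1)
  rw [abs_le'] at hlower₀ hlower₁
  rw [himage]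
  change 4⁻¹ * |2 * v 0 + v 1| < |v 0 + v 1| ∧ 4⁻¹ * |v 0 + v 1| < |2 * v 0 + v 1|
  rcases hle with hle | hle <;> constructor <;> linarith

theorem pow_mulVec_mem_horizontalCone {M : Matrix (Fin 2) (Fin 2) ℝ}
    (hM : ∀ v ≠ 0, v ∈ verticalCone ∨ M *ᵥ v ∈ horizontalCone) {v : Fin 2 → ℝ}
    (hv : v ∈ obliqueCone) {n : ℕ} (hn : n ≠ 0) : M ^ n *ᵥ v ∈ horizontalCone := by
  rw [← Nat.one_le_iff_ne_zero] at hn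
  induction n, hn using Nat.le_induction with
  | base =>
    rw [pow_one]
    exact (hM v (ne_of_mem_of_not_mem hv zero_notMem_obliqueCone)).resolve_left
      (disjoint_verticalCone_obliqueCone.notMem_of_mem_right hv)
  | succ n _ ih =>
    rw [pow_succ', ← Matrix.mulVec_mulVec]
    exact (hM _ (ne_of_mem_of_not_mem ih zero_notMem_horizontalCone)).resolve_left
      (disjoint_verticalCone_horizontalCone.notMem_of_mem_right ih)

end Cones

theorem conj_inr_smul_image_inl {N H : Type*} [Group N] [Group H] {φ : H →* MulAut N} (h : H)
    (A : Set N) :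
    MulAut.conj (SemidirectProduct.inr h : N ⋊[φ] H) • (SemidirectProduct.inl '' A) =
      (SemidirectProduct.inl '' (φ h • A) : Set (N ⋊[φ] H)) := by
  simp only [← Set.image_smul, Set.image_image, MulAut.smul_def, MulAut.conj_apply,
    SemidirectProduct.inl_aut, map_inv]

namespace PlaneSemidirect

variable (Γ : Subgroup SL(2, ℝ))

theorem isOpenEmbedding_inl :
    IsOpenEmbedding (SemidirectProduct.inl : Multiplicative (Fin 2 → ℝ) →* PlaneSemidirect Γ) := by
  let _ : TopologicalSpace Γ := ⊥
  have : DiscreteTopology Γ := ⟨rfl⟩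
  have hinl : Continuous (SemidirectProduct.inl : _ →* PlaneSemidirect Γ) :=
    continuous_induced_rng.2 (continuous_id.prodMk continuous_const)
  refine ⟨Function.LeftInverse.isEmbedding SemidirectProduct.left_inl (continuous_left Γ) hinl, ?_⟩
  rw [← MonoidHom.coe_range, SemidirectProduct.range_inl_eq_ker_rightHom]
  exact (isOpen_discrete {(1 : Γ)}).preimage (continuous_right Γ)

instance neBot_nhdsNE_one : (𝓝[≠] (1 : PlaneSemidirect Γ)).NeBot := by
  have hzero : (𝓝[≠] (1 : Multiplicative (Fin 2 → ℝ))).NeBot :=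
    inferInstanceAs (𝓝[≠] (0 : Fin 2 → ℝ)).NeBot
  have hinl : Tendsto (SemidirectProduct.inl : _ →* PlaneSemidirect Γ) (𝓝[≠] 1) (𝓝[≠] 1) := by
    have hcont := (isOpenEmbedding_inl Γ).continuous.tendsto 1
    rw [map_one] at hcont
    refine tendsto_nhdsWithin_iff.2 ⟨hcont.mono_left nhdsWithin_le_nhds, ?_⟩
    filter_upwards [self_mem_nhdsWithin] with v hv
    exact fun h => hv (SemidirectProduct.inl_injective (h.trans (map_one _).symm))
  exact hinl.neBot

variable {Γ}

/-- The subset `P` of the plane as a subset of the normal subgroup `ℝ²` of `ℝ² ⋊ Γ`. -/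
def planeSet (Γ : Subgroup SL(2, ℝ)) (P : Set (Fin 2 → ℝ)) : Set (PlaneSemidirect Γ) :=
  SemidirectProduct.inl '' (Multiplicative.toAdd ⁻¹' P)

theorem isOpen_planeSet {P : Set (Fin 2 → ℝ)} (hP : IsOpen P) : IsOpen (planeSet Γ P) :=
  (isOpenEmbedding_inl Γ).isOpenMap _ (hP.preimage continuous_toAdd)

theorem conj_inr_smul_planeSet (γ : Γ) (P : Set (Fin 2 → ℝ)) :
    MulAut.conj (SemidirectProduct.inr γ : PlaneSemidirect Γ) • planeSet Γ P =
      planeSet Γ {v | ((γ⁻¹ : Γ) : SL(2, ℝ)).1 *ᵥ v ∈ P} := by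
  rw [planeSet, conj_inr_smul_image_inl, planeSet]
  congr 1
  ext v
  rw [Set.mem_smul_set_iff_inv_smul_mem, ← map_inv]
  rfl

theorem not_isQSIN_of_pow_mulVec_notMem {P : Set (Fin 2 → ℝ)} (hP : IsOpen P) {γ η : SL(2, ℝ)}
    (hγΓ : γ ∈ Γ) (hηΓ : η ∈ Γ) (hγ : ∀ n ≠ 0, ∀ v ∈ P, γ.1 ^ n *ᵥ v ∉ P)
    (hη : ∀ v ≠ 0, v ∈ P ∨ η.1 *ᵥ v ∈ P) : ¬ IsQSIN (PlaneSemidirect Γ) := by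
  refine not_isQSIN_of_disjoint_conj_pow_smul (W := planeSet Γ P) (U := planeSet Γ Set.univ)
    (isOpen_planeSet hP).measurableSet (g := SemidirectProduct.inr ⟨γ, hγΓ⟩⁻¹) (fun n hn => ?_)
    (measure_singleton 1) ![1, SemidirectProduct.inr ⟨η, hηΓ⟩⁻¹]
    ((isOpen_planeSet isOpen_univ).mem_nhds ⟨1, trivial, map_one _⟩) ?_
  · rw [← map_pow, ← map_pow, conj_inr_smul_planeSet, planeSet, planeSet,
      Set.disjoint_image_iff (isOpenEmbedding_inl Γ).injective]
    refine Set.disjoint_left.2 fun v hv => ?_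
    simpa only [Set.mem_preimage, Set.mem_ofPred_eq, inv_pow, inv_inv, Subgroup.coe_pow,
      Matrix.SpecialLinearGroup.coe_pow] using hγ n hn v.toAdd hv
  · rintro _ ⟨v, -, rfl⟩
    by_cases hv : v = 1
    · exact Or.inl (by simp [hv])
    refine Or.inr (Set.mem_iUnion.2 ((hη v.toAdd hv).elim (fun h => ⟨0, ?_⟩) fun h => ⟨1, ?_⟩))
    · rw [Matrix.cons_val_zero, map_one, one_smul]
      exact Set.mem_image_of_mem _ h
    · rw [Matrix.cons_val_one, Matrix.cons_val_fin_one, conj_inr_smul_planeSet, inv_inv]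
      exact Set.mem_image_of_mem _ h

end PlaneSemidirect

theorem mainTheorem5 (Γ : Subgroup SL(2, ℝ)) (hΓ : Dense (Γ : Set SL(2, ℝ))) :
    ¬ IsQSIN (PlaneSemidirect Γ) := by
  obtain ⟨γ, hγΓ, hγ⟩ := isOpenCone_verticalCone.exists_mem_forall_mem_or_mulVec_mem hΓ
    isOpenCone_horizontalCone ⟨!![5, 0; 0, 5⁻¹], by simp [Matrix.det_fin_two]⟩
    fun _ => mem_verticalCone_or_diagonal_mulVec_mem_horizontalCone
  obtain ⟨η, hηΓ, hη⟩ := isOpenCone_obliqueCone.exists_mem_forall_mem_or_mulVec_mem hΓ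
    isOpenCone_obliqueCone ⟨!![2, 1; 1, 1], by norm_num [Matrix.det_fin_two]⟩
    fun _ => mem_obliqueCone_or_mulVec_mem_obliqueCone
  have hwandering (n : ℕ) (hn : n ≠ 0) (v : Fin 2 → ℝ) (hv : v ∈ obliqueCone) :
      γ.1 ^ n *ᵥ v ∉ obliqueCone :=
    disjoint_horizontalCone_obliqueCone.notMem_of_mem_left (pow_mulVec_mem_horizontalCone hγ hv hn)
  exact PlaneSemidirect.not_isQSIN_of_pow_mulVec_notMem isOpenCone_obliqueCone.isOpen hγΓ hηΓ
    hwandering hη
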